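/- Let $\Gamma$ be a finite simplicial graph with vertex set $V(\Gamma)$ and let $W_\Gamma=\langle V(\Gamma)\mid s^2=1\ (s\in V(\Gamma)),\ st=ts\ (s,t\text{ adjacent})\rangle$ be the associated right-angled Coxeter group. A *$\Gamma$-labeled cube complex* is a cube complex (cells of which may be glued to themselves along faces) whose edges are labeled by vertices of $\Gamma$, so that parallel edges of a cube have the same label and the edges of a cube at any one of its corners have pairwise distinct, pairwise adjacent labels. It is *folded* if no two distinct edges sharing an endpoint have the same label and no two distinct $i$-cubes with $i\ge 2$ have the same boundary (attaching map, up to an isometry of the cube); it is *cube-full* if any $i$ edges incident to a common vertex, whose labels form an $i$-clique in $\Gamma$, are contained in a common $i$-cube. Let $G\le W_\Gamma$ be a subgroup. A connected $\Gamma$-labeled cube complex $\Omega$ with a base vertex $B$ is a *completion* of $G$ if it is folded and cube-full, if the label of every loop based at $B$ in the $1$-skeleton (backtracking allowed) represents an element of $G$, and if every reduced (shortest) word that represents an element of $G$ is the label of such a loop. The completion is *resolved* if for each $s\in V(\Gamma)$ that is adjacent to all other vertices of $\Gamma$ some edge of $\Omega$ is labeled by $s$. It has *full valence* if for each vertex $p$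 of $\Omega$ and each $s\in V(\Gamma)$ some edge labeled by $s$ is incident to $p$. Let $(\Omega,B)$ be a completion of $G$. 1. If $\Omega$ is resolved, then $G$ has finite index in $W_\Gamma$ if and only if $\Omega$ is finite (has finitely many cells) and has full valence. 2. If $\Omega$ has full valence (whether or not it is resolved), then the index of $G$ in $W_\Gamma$ equals, as a possibly infinite cardinal, the number of vertices of $\Omega$. -/

import Mathlib

universe u v

open scoped Cardinal

/-! ## Right-angled Coxeter groups -/

open Classical in
/-- The Coxeter matrix of a right-angled Coxeter group: `m(s,s) = 1`, `m(s,t) = 2` if `s` and `t`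
are adjacent in `Γ`, and `m(s,t) = ∞` (which Mathlib encodes as `0`) otherwise. -/
noncomputable def racgMatrix {S : Type u} (Γ : SimpleGraph S) : CoxeterMatrix S where
  M := Matrix.of fun s t => if s = t then 1 else if Γ.Adj s t then 2 else 0
  isSymm := by
    ext s t
    simp only [Matrix.transpose_apply, Matrix.of_apply, eq_comm (a := t) (b := s),
      Γ.adj_comm t s]
  diagonal := by intro s; simp
  off_diagonal := by
    intro s t h
    simp only [Matrix.of_apply, if_neg h]
    split_ifs <;> simp

/-- The right-angled Coxeter group `W_Γ`. -/
abbrev RACG {S : Type u} (Γ : SimpleGraph S) : Type u := (racgMatrix Γ).Group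

/-- The element of `W_Γ` represented by a word in the letters `S = V(Γ)`. -/
noncomputable def wordElt {S : Type u} (Γ : SimpleGraph S) (w : List S) : RACG Γ :=
  (racgMatrix Γ).toCoxeterSystem.wordProd w

/-- A word is reduced if no word representing the same element of `W_Γ` is shorter. -/
def IsReducedWord {S : Type u} (Γ : SimpleGraph S) (w : List S) : Prop :=
  ∀ w' : List S, wordElt Γ w' = wordElt Γ w → w.length ≤ w'.length

/-! ## Faces of cubes -/

/-- An isometric embedding of the `m`-cube onto an `m`-dimensional face of the `n`-cube. It is
determined by the directions `dir i` of the images of the coordinate directions, and by the vertex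
`base` of the `n`-cube (a vertex of the `n`-cube is a map `Fin n → Bool`) which is the image of the
vertex `(0, …, 0)`. For `m = n` these are the isometries of the `n`-cube. -/
@[ext]
structure CubeEmb (m n : ℕ) where
  dir : Fin m ↪ Fin n
  base : Fin n → Bool

namespace CubeEmb

open Classical in
/-- The image of a vertex `x` of the `m`-cube: starting from `base`, one moves in the direction
`dir i` for each `i` with `x i = 1`. -/
noncomputable def onVertex {m n : ℕ} (f : CubeEmb m n) (x : Fin m → Bool) : Fin n → Bool :=
  fun j => xor (f.base j) (decide (∃ i, f.dir i = j ∧ x i = true))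

/-- The identity of the `n`-cube. -/
def id (n : ℕ) : CubeEmb n n where
  dir := Function.Embedding.refl _
  base := fun _ => false

/-- `g.comp f` is the composite `g ∘ f`. -/
noncomputable def comp {l m n : ℕ} (g : CubeEmb m n) (f : CubeEmb l m) : CubeEmb l n where
  dir := f.dir.trans g.dir
  base := g.onVertex f.base

/-- The vertex `b` of the `n`-cube. -/
def vertex {n : ℕ} (b : Fin n → Bool) : CubeEmb 0 n where
  dir := Function.Embedding.ofIsEmpty
  base := b

end CubeEmb

/-! ## Cube complexes -/

/-- A cube complex, given combinatorially. `Cube n` is the set of *parametrized* `n`-cubes, that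
is, of the characteristic maps `[-1/2, 1/2]^n → Ω` of the `n`-cells, precomposed with arbitrary
isometries of the standard `n`-cube; `res f x` is the composite `x ∘ f`, which is again a
parametrized cube because each face of each cell is attached isometrically to a cell. Each `n`-cell
has exactly `2 ^ n * n!` distinct parametrizations (`res_free`), since characteristic maps are
injective on the interior of the cube. An `n`-cell is thus a class of parametrized `n`-cubes up to
the isometries of the `n`-cube (see `SameCell`). Different faces of one cell may be glued to each
other. -/
structure CubeComplex where
  Cube : ℕ → Type v
  res : ∀ {m n : ℕ}, CubeEmb m n → Cube n → Cube m
  res_id : ∀ {n : ℕ} (x : Cube n), res (CubeEmb.id n) x = x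
  res_comp : ∀ {l m n : ℕ} (g : CubeEmb m n) (f : CubeEmb l m) (x : Cube n),
    res (g.comp f) x = res f (res g x)
  res_free : ∀ {n : ℕ} (g : CubeEmb n n) (x : Cube n), res g x = x → g = CubeEmb.id n

namespace CubeComplex

variable (Ω : CubeComplex.{v})

/-- Vertices (the `0`-cube has only one isometry). -/
abbrev Vertex : Type v := Ω.Cube 0

/-- Parametrized `1`-cubes, that is, edges together with an orientation. -/
abbrev OrientedEdge : Type v := Ω.Cube 1

variable {Ω}

/-- Initial vertex of an oriented edge. -/
def src (e : Ω.OrientedEdge) : Ω.Vertex := Ω.res (CubeEmb.vertex fun _ => false) e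

/-- Terminal vertex of an oriented edge. -/
def tgt (e : Ω.OrientedEdge) : Ω.Vertex := Ω.res (CubeEmb.vertex fun _ => true) e

/-- Two parametrized cubes parametrize the same cell. -/
def SameCell {n : ℕ} (x y : Ω.Cube n) : Prop := ∃ g : CubeEmb n n, Ω.res g x = y

/-- The cells of `x` and `y`, parametrized as given, have the same boundary: the two characteristic
maps agree on every proper face of the `n`-cube. -/
def SameBoundary {n : ℕ} (x y : Ω.Cube n) : Prop :=
  ∀ (m : ℕ) (f : CubeEmb m n), m < n → Ω.res f x = Ω.res f y

variable (Ω)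

/-- The complex has finitely many cells. (Each cell has finitely many parametrizations.) -/
def IsFinite : Prop := Finite (Σ n : ℕ, Ω.Cube n)

end CubeComplex

/-- A `Γ`-labeled cube complex: each edge is labeled by a vertex of `Γ`, such that edges of a cube
which are dual to a common midcube (that is, parallel in the cube) have the same label, and
different edges of a cube at a common vertex of the cube have distinct labels which are adjacent in
`Γ`. The case `n = 1` of `label_parallel` says that the label does not depend on the
orientation of the edge. -/
structure LabeledCubeComplex {S : Type u} (Γ : SimpleGraph S) extends CubeComplex.{v} where
  label : Cube 1 → S
  label_parallel : ∀ {n : ℕ} (x : Cube n) (f g : CubeEmb 1 n),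
    f.dir 0 = g.dir 0 → label (res f x) = label (res g x)
  label_corner : ∀ {n : ℕ} (x : Cube n) (f g : CubeEmb 1 n),
    f.base = g.base → f.dir 0 ≠ g.dir 0 → Γ.Adj (label (res f x)) (label (res g x))

namespace LabeledCubeComplex

open CubeComplex

variable {S : Type u} {Γ : SimpleGraph S} (Ω : LabeledCubeComplex.{u, v} Γ)

/-- `Ω.HasPath p w q`: some path in the `1`-skeleton of `Ω` from the vertex `p` to the vertex `q`
has label `w`. -/
inductive HasPath : Ω.Vertex → List S → Ω.Vertex → Prop
  | nil (p : Ω.Vertex) : HasPath p [] p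
  | cons {p q : Ω.Vertex} {w : List S} (e : Ω.OrientedEdge) (he : src e = p)
      (h : HasPath (tgt e) w q) : HasPath p (Ω.label e :: w) q

/-- Any two vertices are joined by a path in the `1`-skeleton. -/
def Connected : Prop := ∀ p q : Ω.Vertex, ∃ w : List S, Ω.HasPath p w q

/-- Some edge incident to the vertex `p` has label `s`. -/
def HasEdgeAt (p : Ω.Vertex) (s : S) : Prop := ∃ e : Ω.OrientedEdge, src e = p ∧ Ω.label e = s

/-- No fold operation is possible (distinct edges with a common endpoint have distinct labels), and
no cube identification operation is possible (distinct cells of dimension at least `2` have distinct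
boundaries). -/
structure Folded : Prop where
  no_fold : ∀ e e' : Ω.OrientedEdge, src e = src e' → Ω.label e = Ω.label e' → SameCell e e'
  no_cube_identification : ∀ (n : ℕ) (x y : Ω.Cube n), 2 ≤ n → SameBoundary x y → SameCell x y

/-- Any `n` edges at a common vertex, whose labels form an `n`-clique of `Γ`, are contained in a
common `n`-cube. -/
def CubeFull : Prop :=
  ∀ (n : ℕ) (p : Ω.Vertex) (e : Fin n → Ω.OrientedEdge), (∀ i, src (e i) = p) →
    (∀ i j, i ≠ j → Γ.Adj (Ω.label (e i)) (Ω.label (e j))) →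
    ∃ c : Ω.Cube n, ∀ i, ∃ f : CubeEmb 1 n, Ω.res f c = e i

/-- `(Ω, B)` is a completion of the subgroup `G` of `W_Γ`. -/
structure IsCompletion (B : Ω.Vertex) (G : Subgroup (RACG Γ)) : Prop where
  connected : Ω.Connected
  folded : Ω.Folded
  cubeFull : Ω.CubeFull
  loop_mem : ∀ w : List S, Ω.HasPath B w B → wordElt Γ w ∈ G
  reduced_loop : ∀ w : List S, IsReducedWord Γ w → wordElt Γ w ∈ G → Ω.HasPath B w B

/-- For every `s` whose star is all of `V(Γ)`, some edge is labeled by `s`. -/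
def Resolved : Prop :=
  ∀ s : S, insert s (Γ.neighborSet s) = Set.univ → ∃ e : Ω.OrientedEdge, Ω.label e = s

/-- Every vertex is incident to edges of all labels. -/
def FullValence : Prop := ∀ (p : Ω.Vertex) (s : S), Ω.HasEdgeAt p s

end LabeledCubeComplex

/-!
In a folded cube-full complex `Ω` an edge is determined by its initial vertex and its label, and two
edges at a vertex with adjacent labels span a square (`exists_square`). Hence each label `s` defines
a partial involution of the vertices, and those of adjacent labels commute.

If `Ω` has full valence, the involutions are defined everywhere, and so they define an action of
`W_Γ` on the vertices. It is transitive as `Ω` is connected, and by the definition of a completion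
the stabilizer of `B` is `G`. So the index of `G` is the number of vertices
(`IsCompletion.index_eq`). If this is finite then so is `Ω`, because a cell is determined by its
boundary and its dimension is at most the number of labels (`Folded.isFinite`).

It remains to show that a resolved completion has full valence if `G` has finite index
(`IsCompletion.fullValence`). If `s` is adjacent to all other vertices of `Γ`, then squares carry
the edge labeled by `s`, which exists as `Ω` is resolved, along paths to any vertex. Otherwise some
`t ≠ s` is not adjacent to `s`. For a vertex `p`, the finiteness of the index yields a loop at `p`
whose label represents a power of `st`. The word problem in `W_Γ` then shows that also `st⋯st` is the
label of a loop at `p`, so `p` is incident to an edge labeled by `s`.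

The word problem enters as follows: each word can be brought into a normal form by commuting
adjacent letters and cancelling pairs of equal letters, operations which can be carried out on paths
in `Ω` (`HasPath.normalForm`); and the normal form is determined by the element of `W_Γ` up to
commuting adjacent letters (`RACGWord.shuffle_normalForm`), because `W_Γ` acts by left
multiplication on the words in normal form, taken up to such commutations.
-/

/-! ### Homomorphisms out of a right-angled Coxeter group -/

theorem wordElt_append {S : Type u} (Γ : SimpleGraph S) (w w' : List S) :
    wordElt Γ (w ++ w') = wordElt Γ w * wordElt Γ w' :=
  CoxeterSystem.wordProd_append _ _ _

theorem wordElt_reverse {S : Type u} (Γ : SimpleGraph S) (w : List S) :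
    wordElt Γ w.reverse = (wordElt Γ w)⁻¹ :=
  CoxeterSystem.wordProd_reverse _ _

theorem exists_isReducedWord {S : Type u} (Γ : SimpleGraph S) (g : RACG Γ) :
    ∃ w, IsReducedWord Γ w ∧ wordElt Γ w = g := by
  have h : ∃ n, ∃ w : List S, wordElt Γ w = g ∧ w.length = n := by
    obtain ⟨w, hw⟩ := (racgMatrix Γ).toCoxeterSystem.wordProd_surjective g
    exact ⟨_, w, hw, rfl⟩
  classical
  obtain ⟨w, hw, hl⟩ := Nat.find_spec h
  refine ⟨w, fun w' hw' => ?_, hw⟩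
  rw [hl]
  exact Nat.find_min' h ⟨w', hw'.trans hw, rfl⟩

theorem exists_monoidHom_wordElt {S : Type u} (Γ : SimpleGraph S) {M : Type*} [Monoid M]
    (f : S → M) (hsq : ∀ s, f s * f s = 1) (hcomm : ∀ s t, Γ.Adj s t → f s * f t = f t * f s) :
    ∃ φ : RACG Γ →* M, ∀ w, φ (wordElt Γ w) = (w.map f).prod := by
  have hf : (racgMatrix Γ).IsLiftable f := by
    intro s t
    simp only [racgMatrix, Matrix.of_apply]
    split_ifs with h₁ h₂
    · rw [h₁, pow_one, hsq]
    · rw [pow_two]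
      calc f s * f t * (f s * f t) = f s * f t * (f t * f s) := by rw [hcomm s t h₂]
        _ = f s * (f t * f t) * f s := by simp only [mul_assoc]
        _ = 1 := by rw [hsq, mul_one, hsq]
    · rw [pow_zero]
  refine ⟨(racgMatrix Γ).toCoxeterSystem.lift ⟨f, hf⟩, fun w => ?_⟩
  induction w with
  | nil => simp [wordElt]
  | cons s w ih =>
    rw [wordElt, CoxeterSystem.wordProd_cons, map_mul, CoxeterSystem.lift_apply_simple,
      List.map_cons, List.prod_cons, ← ih, wordElt]

/-! ### The word problem in a right-angled Coxeter group -/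

namespace RACGWord

variable {S : Type u} (Γ : SimpleGraph S)

/-- Words that differ by a sequence of transpositions of neighboring letters which are adjacent in
`Γ`. -/
inductive Shuffle : List S → List S → Prop
  | nil : Shuffle [] []
  | cons (x : S) {u v : List S} (h : Shuffle u v) : Shuffle (x :: u) (x :: v)
  | swap {x y : S} (h : Γ.Adj x y) (u : List S) : Shuffle (x :: y :: u) (y :: x :: u)
  | trans {u v w : List S} (h₁ : Shuffle u v) (h₂ : Shuffle v w) : Shuffle u w

open Classical in
/-- Deletes the first occurrence of `x` in a word, provided that all letters in front of it are
adjacent to `x`, so that `x` can be shuffled to the front; the value is `none` otherwise. -/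
noncomputable def eraseFront (x : S) : List S → Option (List S)
  | [] => none
  | y :: u => if y = x then some u else
      if Γ.Adj x y then (eraseFront x u).map (y :: ·) else none

/-- Left multiplication of a word by the letter `x`: a letter `x` that can be shuffled to the front
is cancelled. -/
noncomputable def leftMul (x : S) (u : List S) : List S := (eraseFront Γ x u).getD (x :: u)

/-- No two letters of the word can be shuffled next to each other and cancelled. -/
inductive NoCancel : List S → Prop
  | nil : NoCancel []
  | cons {x : S} {u : List S} (h : NoCancel u) (hx : eraseFront Γ x u = none) : NoCancel (x :: u)

variable {Γ}

namespace Shuffle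

theorem refl (u : List S) : Shuffle Γ u u := by
  induction u with
  | nil => exact .nil
  | cons x u ih => exact .cons x ih

theorem symm {u v : List S} (h : Shuffle Γ u v) : Shuffle Γ v u := by
  induction h with
  | nil => exact .nil
  | cons x _ ih => exact .cons x ih
  | swap h u => exact .swap h.symm u
  | trans _ _ ih₁ ih₂ => exact .trans ih₂ ih₁

end Shuffle

theorem eraseFront_cons_self (x : S) (u : List S) : eraseFront Γ x (x :: u) = some u := by
  simp [eraseFront]

theorem eraseFront_cons_of_adj {x y : S} (h : Γ.Adj x y) (u : List S) :
    eraseFront Γ x (y :: u) = (eraseFront Γ x u).map (y :: ·) := by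
  simp [eraseFront, h, h.ne']

theorem eraseFront_cons_of_not_adj {x y : S} (hne : y ≠ x) (h : ¬ Γ.Adj x y) (u : List S) :
    eraseFront Γ x (y :: u) = none := by
  simp [eraseFront, h, hne]

theorem shuffle_of_eraseFront {x : S} {u v : List S} (h : eraseFront Γ x u = some v) :
    Shuffle Γ u (x :: v) := by
  induction u generalizing v with
  | nil => simp [eraseFront] at h
  | cons y u ih =>
    by_cases hxy : y = x
    · subst hxy
      rw [eraseFront_cons_self, Option.some.injEq] at h
      exact h ▸ .refl _
    · by_cases hadj : Γ.Adj x y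
      · rw [eraseFront_cons_of_adj hadj, Option.map_eq_some_iff] at h
        obtain ⟨v', hv', rfl⟩ := h
        exact .trans (.cons y (ih hv')) (.swap hadj.symm v')
      · simp [eraseFront_cons_of_not_adj hxy hadj] at h

theorem Shuffle.eraseFront {u v : List S} (h : Shuffle Γ u v) (x : S) :
    Option.Rel (Shuffle Γ) (eraseFront Γ x u) (eraseFront Γ x v) := by
  induction h with
  | nil => exact .none
  | @cons y u v h ih =>
    by_cases hxy : y = x
    · subst hxy
      simpa only [eraseFront_cons_self] using .some h
    · by_cases hadj : Γ.Adj x y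
      · rw [eraseFront_cons_of_adj hadj, eraseFront_cons_of_adj hadj]
        revert ih
        generalize RACGWord.eraseFront Γ x u = a
        generalize RACGWord.eraseFront Γ x v = b
        rintro (h' | _)
        · exact .some (.cons y h')
        · exact .none
      · simpa only [eraseFront_cons_of_not_adj hxy hadj] using .none
  | @swap y z h u =>
    by_cases hy : y = x
    · subst hy
      rw [eraseFront_cons_self, eraseFront_cons_of_adj h, eraseFront_cons_self]
      exact .some (.refl _)
    by_cases hz : z = x
    · subst hz
      rw [eraseFront_cons_self, eraseFront_cons_of_adj h.symm, eraseFront_cons_self]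
      exact .some (.refl _)
    by_cases hay : Γ.Adj x y <;> by_cases haz : Γ.Adj x z
    · rw [eraseFront_cons_of_adj hay, eraseFront_cons_of_adj haz, eraseFront_cons_of_adj haz,
        eraseFront_cons_of_adj hay]
      cases RACGWord.eraseFront Γ x u with
      | none => exact .none
      | some w => exact .some (.swap h w)
    · rw [eraseFront_cons_of_adj hay, eraseFront_cons_of_not_adj hz haz,
        eraseFront_cons_of_not_adj hz haz]
      exact .none
    · rw [eraseFront_cons_of_adj haz, eraseFront_cons_of_not_adj hy hay,
        eraseFront_cons_of_not_adj hy hay]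
      exact .none
    · rw [eraseFront_cons_of_not_adj hz haz, eraseFront_cons_of_not_adj hy hay]
      exact .none
  | @trans u v w _ _ ih₁ ih₂ =>
    revert ih₁ ih₂
    generalize RACGWord.eraseFront Γ x u = a
    generalize RACGWord.eraseFront Γ x v = b
    generalize RACGWord.eraseFront Γ x w = c
    rintro (h₁ | _) (h₂ | _)
    · exact .some (.trans h₁ h₂)
    · exact .none

theorem Shuffle.eraseFront_eq_none {u v : List S} (h : Shuffle Γ u v) {x : S}
    (hu : RACGWord.eraseFront Γ x u = none) : RACGWord.eraseFront Γ x v = none := by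
  have h' := h.eraseFront x
  rw [hu] at h'
  revert h'
  generalize RACGWord.eraseFront Γ x v = b
  rintro ⟨⟩
  rfl

theorem Shuffle.leftMul {u v : List S} (h : Shuffle Γ u v) (x : S) :
    Shuffle Γ (leftMul Γ x u) (leftMul Γ x v) := by
  have h' := h.eraseFront x
  unfold RACGWord.leftMul
  revert h'
  generalize RACGWord.eraseFront Γ x u = a
  generalize RACGWord.eraseFront Γ x v = b
  rintro (h' | _)
  · exact h'
  · exact .cons x h

theorem NoCancel.of_shuffle {u v : List S} (h : Shuffle Γ u v) (hu : NoCancel Γ u) :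
    NoCancel Γ v := by
  induction h with
  | nil => exact hu
  | cons x h ih =>
    cases hu with
    | cons hu hx => exact .cons (ih hu) (h.eraseFront_eq_none hx)
  | swap h u =>
    cases hu with
    | cons hu hx =>
      cases hu with
      | cons hu hy =>
        rw [eraseFront_cons_of_adj h, Option.map_eq_none_iff] at hx
        refine .cons (.cons hu hx) ?_
        rw [eraseFront_cons_of_adj h.symm, hy, Option.map_none]
  | trans _ _ ih₁ ih₂ => exact ih₂ (ih₁ hu)

theorem NoCancel.of_eraseFront {x : S} {u v : List S} (hu : NoCancel Γ u)
    (h : eraseFront Γ x u = some v) : NoCancel Γ v ∧ eraseFront Γ x v = none := by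
  cases hu.of_shuffle (shuffle_of_eraseFront h) with
  | cons hv hx => exact ⟨hv, hx⟩

theorem leftMul_of_none {x : S} {u : List S} (h : eraseFront Γ x u = none) :
    leftMul Γ x u = x :: u := by
  rw [leftMul, h, Option.getD_none]

theorem leftMul_of_some {x : S} {u v : List S} (h : eraseFront Γ x u = some v) :
    leftMul Γ x u = v := by
  rw [leftMul, h, Option.getD_some]

theorem NoCancel.leftMul {u : List S} (hu : NoCancel Γ u) (x : S) :
    NoCancel Γ (leftMul Γ x u) := by
  cases h : eraseFront Γ x u with
  | none => exact leftMul_of_none h ▸ .cons hu h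
  | some v => exact leftMul_of_some h ▸ (hu.of_eraseFront h).1

theorem leftMul_leftMul_self {u : List S} (hu : NoCancel Γ u) (x : S) :
    Shuffle Γ (leftMul Γ x (leftMul Γ x u)) u := by
  cases h : eraseFront Γ x u with
  | none =>
    rw [leftMul_of_none h, leftMul_of_some (eraseFront_cons_self x u)]
    exact .refl u
  | some v =>
    rw [leftMul_of_some h, leftMul_of_none (hu.of_eraseFront h).2]
    exact (shuffle_of_eraseFront h).symm

/-- The case of `leftMul_comm` in which `x` is the first letter of the word. -/
theorem leftMul_comm_cons_self {x y : S} (hxy : Γ.Adj x y) (v : List S) :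
    Shuffle Γ (leftMul Γ x (leftMul Γ y (x :: v))) (leftMul Γ y (leftMul Γ x (x :: v))) := by
  rw [leftMul_of_some (eraseFront_cons_self x v)]
  cases hy : eraseFront Γ y v with
  | none =>
    have h : eraseFront Γ y (x :: v) = none := by
      rw [eraseFront_cons_of_adj hxy.symm, hy, Option.map_none]
    have h' : eraseFront Γ x (y :: x :: v) = some (y :: v) := by
      rw [eraseFront_cons_of_adj hxy, eraseFront_cons_self, Option.map_some]
    rw [leftMul_of_none h, leftMul_of_some h', leftMul_of_none hy]
    exact .refl _
  | some v' =>
    have h : eraseFront Γ y (x :: v) = some (x :: v') := by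
      rw [eraseFront_cons_of_adj hxy.symm, hy, Option.map_some]
    rw [leftMul_of_some h, leftMul_of_some (eraseFront_cons_self x v'), leftMul_of_some hy]
    exact .refl _

theorem leftMul_comm {x y : S} (hxy : Γ.Adj x y) (u : List S) :
    Shuffle Γ (leftMul Γ x (leftMul Γ y u)) (leftMul Γ y (leftMul Γ x u)) := by
  -- If a letter can be erased from `u`, then `u` may be replaced by a word starting with it.
  have key : ∀ {x y : S}, Γ.Adj x y → ∀ {v : List S}, eraseFront Γ x u = some v →
      Shuffle Γ (leftMul Γ x (leftMul Γ y u)) (leftMul Γ y (leftMul Γ x u)) := by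
    intro x y hxy v hv
    have h := shuffle_of_eraseFront hv
    exact ((h.leftMul y).leftMul x).trans
      ((leftMul_comm_cons_self hxy v).trans
        ((h.leftMul x).leftMul y).symm)
  cases hx : eraseFront Γ x u with
  | some v => exact key hxy hx
  | none =>
    cases hy : eraseFront Γ y u with
    | some v => exact (key hxy.symm hy).symm
    | none =>
      have h : eraseFront Γ x (y :: u) = none := by
        rw [eraseFront_cons_of_adj hxy, hx, Option.map_none]
      have h' : eraseFront Γ y (x :: u) = none := by
        rw [eraseFront_cons_of_adj hxy.symm, hy, Option.map_none]
      rw [leftMul_of_none hx, leftMul_of_none hy, leftMul_of_none h, leftMul_of_none h']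
      exact .swap hxy u

variable (Γ) in
/-- The normal form of a word, which is well-defined up to shuffles: the letters are multiplied
successively from the left, starting at the empty word. -/
noncomputable def normalForm (w : List S) : List S := w.foldr (leftMul Γ) []

theorem noCancel_normalForm (w : List S) : NoCancel Γ (normalForm Γ w) := by
  induction w with
  | nil => exact .nil
  | cons x w ih => exact ih.leftMul x

theorem normalForm_eq_self {w : List S} (hw : NoCancel Γ w) : normalForm Γ w = w := by
  induction hw with
  | nil => rfl
  | @cons x u _ hx ih =>
    rw [normalForm, List.foldr_cons, ← normalForm, ih, leftMul_of_none hx]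

variable (Γ) in
/-- Shuffle equivalence of words without cancellation. The classes turn out to be the elements of
`W_Γ`. -/
def shuffleSetoid : Setoid {u : List S // NoCancel Γ u} where
  r u v := Shuffle Γ u.1 v.1
  iseqv := ⟨fun u => .refl u.1, fun h => h.symm, fun h₁ h₂ => h₁.trans h₂⟩

/-- Words representing the same element of `W_Γ` have the same normal form up to shuffles, because
`W_Γ` acts on the shuffle classes of words without cancellation by left multiplication. -/
theorem shuffle_normalForm {w w' : List S} (h : wordElt Γ w = wordElt Γ w') :
    Shuffle Γ (normalForm Γ w) (normalForm Γ w') := by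
  let X := Quotient (shuffleSetoid Γ)
  let f : S → Function.End X := fun x =>
    Quotient.map' (fun u => ⟨leftMul Γ x u.1, u.2.leftMul x⟩) fun _ _ h => Shuffle.leftMul h x
  have hsq : ∀ x, f x * f x = 1 := fun x => funext fun q =>
    Quotient.inductionOn' q fun u => Quotient.sound' (leftMul_leftMul_self u.2 x)
  have hcomm : ∀ x y, Γ.Adj x y → f x * f y = f y * f x := fun x y hxy => funext fun q =>
    Quotient.inductionOn' q fun u => Quotient.sound' (leftMul_comm hxy u.1)
  obtain ⟨φ, hφ⟩ := exists_monoidHom_wordElt Γ f hsq hcomm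
  have key : ∀ w : List S, φ (wordElt Γ w) (Quotient.mk'' ⟨[], .nil⟩) =
      Quotient.mk'' (⟨normalForm Γ w, noCancel_normalForm w⟩ : {u : List S // NoCancel Γ u}) := by
    intro w
    rw [hφ]
    induction w with
    | nil => rfl
    | cons x w ih =>
      rw [List.map_cons, List.prod_cons]
      exact congrArg (f x) ih
  exact Quotient.exact' ((key w).symm.trans (h ▸ key w'))

/-- The powers of `st`, for distinct non-adjacent `s` and `t`, as words without cancellation. -/
theorem noCancel_alternating {s t : S} (hne : s ≠ t) (h : ¬ Γ.Adj s t) (n : ℕ) :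
    NoCancel Γ (List.replicate n [s, t]).flatten := by
  have ht : ∀ n : ℕ, eraseFront Γ t (List.replicate n [s, t]).flatten = none := by
    intro n
    cases n with
    | zero => rfl
    | succ n => exact eraseFront_cons_of_not_adj hne (fun h' => h h'.symm) _
  induction n with
  | zero => exact .nil
  | succ n ih =>
    exact .cons (.cons ih (ht n)) (eraseFront_cons_of_not_adj hne.symm h _)

theorem wordElt_alternating (s t : S) (n : ℕ) :
    wordElt Γ (List.replicate n [s, t]).flatten = wordElt Γ [s, t] ^ n := by
  induction n with
  | zero => simp [wordElt]
  | succ n ih => rw [List.replicate_succ, List.flatten_cons, wordElt_append, ih, pow_succ']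

end RACGWord

/-! ### Edges and squares of a labeled cube complex -/

namespace CubeEmb

/-- The edge of the `n`-cube that starts at the vertex `b` in direction `j`. -/
def edge {n : ℕ} (j : Fin n) (b : Fin n → Bool) : CubeEmb 1 n where
  dir := ⟨fun _ => j, Function.injective_of_subsingleton _⟩
  base := b

theorem onVertex_false {m n : ℕ} (f : CubeEmb m n) : f.onVertex (fun _ => false) = f.base := by
  funext j
  simp [onVertex]

theorem onVertex_true {n : ℕ} (f : CubeEmb 1 n) :
    f.onVertex (fun _ => true) = Function.update f.base (f.dir 0) (!f.base (f.dir 0)) := by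
  funext j
  by_cases h : j = f.dir 0
  · subst h
    simp [onVertex]
  · simp [onVertex, h, Ne.symm h]

theorem comp_vertex {m n : ℕ} (f : CubeEmb m n) (b : Fin m → Bool) :
    f.comp (vertex b) = vertex (f.onVertex b) :=
  CubeEmb.ext (Function.Embedding.ext fun i => i.elim0) rfl

instance (m n : ℕ) : Finite (CubeEmb m n) :=
  Finite.of_injective (fun f => (f.dir, f.base)) fun _ _ h =>
    CubeEmb.ext (congrArg Prod.fst h) (congrArg Prod.snd h)

end CubeEmb

namespace CubeComplex

variable {Ω : CubeComplex.{v}}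

/-- The corner of a parametrized cube at the vertex `b` of the standard cube. -/
def corner {n : ℕ} (c : Ω.Cube n) (b : Fin n → Bool) : Ω.Vertex := Ω.res (CubeEmb.vertex b) c

theorem src_res {n : ℕ} (c : Ω.Cube n) (f : CubeEmb 1 n) : src (Ω.res f c) = corner c f.base := by
  rw [src, ← Ω.res_comp, CubeEmb.comp_vertex, CubeEmb.onVertex_false, corner]

theorem tgt_res {n : ℕ} (c : Ω.Cube n) (f : CubeEmb 1 n) :
    tgt (Ω.res f c) =
      corner c (Function.update f.base (f.dir 0) (!f.base (f.dir 0))) := by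
  rw [tgt, ← Ω.res_comp, CubeEmb.comp_vertex, CubeEmb.onVertex_true, corner]

/-- A cell has only finitely many parametrizations, so an invariant that takes finitely many values
and determines the cell of a parametrized cube bounds the number of parametrized cubes. -/
theorem finite_cube_of_sameCell {n : ℕ} {β : Type*} [Finite β] (f : Ω.Cube n → β)
    (hf : ∀ x y, f x = f y → SameCell x y) : Finite (Ω.Cube n) := by
  choose r hr using fun b : Set.range f => b.2
  choose g hg using fun x => hf (r ⟨f x, x, rfl⟩) x (hr ⟨f x, x, rfl⟩)
  refine Finite.of_injective (fun x => (f x, g x)) fun x y h => ?_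
  have h₁ : f x = f y := congrArg Prod.fst h
  have h₂ : g x = g y := congrArg Prod.snd h
  rw [← hg x, ← hg y, h₂]
  simp only [h₁]

end CubeComplex

namespace LabeledCubeComplex

open CubeComplex

variable {S : Type u} {Γ : SimpleGraph S} {Ω : LabeledCubeComplex.{u, v} Γ}

variable (Ω) in
/-- Some edge labeled by `s` leads from the vertex `p` to the vertex `q`. -/
def Step (p : Ω.Vertex) (s : S) (q : Ω.Vertex) : Prop :=
  ∃ e : Ω.OrientedEdge, src e = p ∧ Ω.label e = s ∧ tgt e = q

theorem HasEdgeAt.exists_step {p : Ω.Vertex} {s : S} (h : Ω.HasEdgeAt p s) :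
    ∃ q, Ω.Step p s q := by
  obtain ⟨e, he, hs⟩ := h
  exact ⟨_, e, he, hs, rfl⟩

theorem Step.hasEdgeAt {p q : Ω.Vertex} {s : S} (h : Ω.Step p s q) : Ω.HasEdgeAt p s := by
  obtain ⟨e, he, hs, -⟩ := h
  exact ⟨e, he, hs⟩

theorem label_res_id (e : Ω.OrientedEdge) (f : CubeEmb 1 1) : Ω.label (Ω.res f e) = Ω.label e := by
  conv_rhs => rw [← Ω.res_id e]
  exact Ω.label_parallel e _ _ (Subsingleton.elim _ _)

theorem Step.symm {p q : Ω.Vertex} {s : S} (h : Ω.Step p s q) : Ω.Step q s p := by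
  obtain ⟨e, rfl, rfl, rfl⟩ := h
  refine ⟨Ω.res (CubeEmb.edge 0 fun _ => true) e, src_res e _, label_res_id e _, ?_⟩
  rw [tgt_res, src]
  congr 2
  funext i
  rw [Subsingleton.elim i 0]
  rfl

theorem step_corner {n : ℕ} (c : Ω.Cube n) (j : Fin n) (b : Fin n → Bool) :
    Ω.Step (corner c b) (Ω.label (Ω.res (CubeEmb.edge j b) c))
      (corner c (Function.update b j (!b j))) :=
  ⟨_, src_res c _, rfl, tgt_res c _⟩

/-- The end of an edge is determined by its start and its label, also if the two edges compared are
equal only up to orientation. -/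
theorem Folded.step_unique (hΩ : Ω.Folded) {p q q' : Ω.Vertex} {s : S} (h : Ω.Step p s q)
    (h' : Ω.Step p s q') : q = q' := by
  obtain ⟨e, he, hs, rfl⟩ := h
  obtain ⟨e', he', hs', rfl⟩ := h'
  obtain ⟨g, rfl⟩ := hΩ.no_fold e e' (he.trans he'.symm) (hs.trans hs'.symm)
  have hd : g.dir 0 = 0 := Subsingleton.elim _ _
  have hc : ∀ b : Fin 1 → Bool, (b = fun _ => b 0) := fun b => by
    funext i
    rw [Subsingleton.elim i 0]
  rw [tgt_res, hd, hc (Function.update _ _ _), Function.update_self]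
  rw [src_res, hc g.base] at he'
  cases hb : g.base 0 with
  | false => rfl
  | true =>
    -- The second edge is the first one reversed, so both are loops.
    rw [hb] at he'
    exact he'.trans he.symm

/-- Two edges at a vertex with adjacent labels span a square. -/
theorem exists_square (hf : Ω.Folded) (hc : Ω.CubeFull) {r p q : Ω.Vertex} {x y : S}
    (hxy : Γ.Adj x y) (hp : Ω.Step r x p) (hq : Ω.Step r y q) :
    ∃ z, Ω.Step p y z ∧ Ω.Step q x z := by
  obtain ⟨e₀, he₀, rfl, rfl⟩ := hp
  obtain ⟨e₁, he₁, rfl, rfl⟩ := hq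
  obtain ⟨c, hc⟩ := hc 2 r ![e₀, e₁] (by simp [Fin.forall_fin_two, he₀, he₁])
    (by simp [Fin.forall_fin_two, hxy, hxy.symm])
  obtain ⟨f₀, hf₀⟩ := hc 0
  obtain ⟨f₁, hf₁⟩ := hc 1
  obtain rfl : Ω.res f₀ c = e₀ := hf₀
  obtain rfl : Ω.res f₁ c = e₁ := hf₁
  set i := f₀.dir 0
  set j := f₁.dir 0
  set b := f₀.base
  have hij : i ≠ j := fun h => hxy.ne (Ω.label_parallel c f₀ f₁ h)
  rw [src_res] at he₀
  -- The second edge need not start at the corner `b` of the square, but foldedness allows to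
  -- replace it by the edge of the square that does.
  have hl : ∀ b', Ω.label (Ω.res (CubeEmb.edge j b') c) = Ω.label (Ω.res f₁ c) :=
    fun b' => Ω.label_parallel c _ _ rfl
  have hl' : ∀ b', Ω.label (Ω.res (CubeEmb.edge i b') c) = Ω.label (Ω.res f₀ c) :=
    fun b' => Ω.label_parallel c _ _ rfl
  have hq : tgt (Ω.res f₁ c) = corner c (Function.update b j (!b j)) := by
    refine hf.step_unique ⟨_, he₁, rfl, rfl⟩ ?_
    rw [← hl b, ← he₀]
    exact step_corner c j b
  have h₁ := step_corner c j (Function.update b i (!b i))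
  have h₂ := step_corner c i (Function.update b j (!b j))
  rw [hl, Function.update_of_ne hij.symm] at h₁
  rw [hl', Function.update_of_ne hij, Function.update_comm hij.symm] at h₂
  rw [hq, tgt_res]
  exact ⟨_, h₁, h₂⟩

/-! ### Paths and their labels -/

theorem hasPath_nil {p q : Ω.Vertex} : Ω.HasPath p [] q ↔ p = q := by
  constructor
  · rintro ⟨⟩
    rfl
  · rintro rfl
    exact .nil p

theorem hasPath_cons {p q : Ω.Vertex} {x : S} {w : List S} :
    Ω.HasPath p (x :: w) q ↔ ∃ r, Ω.Step p x r ∧ Ω.HasPath r w q := by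
  constructor
  · rintro (_ | ⟨e, he, h⟩)
    exact ⟨_, ⟨e, he, rfl, rfl⟩, h⟩
  · rintro ⟨_, ⟨e, he, rfl, rfl⟩, h⟩
    exact .cons e he h

theorem HasPath.append {p q r : Ω.Vertex} {w w' : List S} (h : Ω.HasPath p w q)
    (h' : Ω.HasPath q w' r) : Ω.HasPath p (w ++ w') r := by
  induction h with
  | nil p => exact h'
  | cons e he _ ih => exact .cons e he (ih h')

theorem HasPath.reverse {p q : Ω.Vertex} {w : List S} (h : Ω.HasPath p w q) :
    Ω.HasPath q w.reverse p := by
  induction h with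
  | nil p => exact .nil p
  | cons e he _ ih =>
    rw [List.reverse_cons]
    exact ih.append (hasPath_cons.2 ⟨_, Step.symm ⟨e, he, rfl, rfl⟩, .nil _⟩)

/-- Labels of paths between two given vertices may be shuffled, as adjacent labels of consecutive
edges span a square. -/
theorem HasPath.shuffle (hf : Ω.Folded) (hc : Ω.CubeFull) {u v : List S}
    (h : RACGWord.Shuffle Γ u v) {p q : Ω.Vertex} (hp : Ω.HasPath p u q) : Ω.HasPath p v q := by
  induction h generalizing p with
  | nil => exact hp
  | cons x _ ih =>
    obtain ⟨r, hr, hp⟩ := hasPath_cons.1 hp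
    exact hasPath_cons.2 ⟨r, hr, ih hp⟩
  | swap hxy u =>
    obtain ⟨r, hr, hp⟩ := hasPath_cons.1 hp
    obtain ⟨r', hr', hp⟩ := hasPath_cons.1 hp
    obtain ⟨z, hz, hz'⟩ := exists_square hf hc hxy hr.symm hr'
    exact hasPath_cons.2 ⟨z, hz, hasPath_cons.2 ⟨r', hz'.symm, hp⟩⟩
  | trans _ _ ih₁ ih₂ => exact ih₂ (ih₁ hp)

/-- The label of a path can be replaced by its normal form: cancelled pairs of letters correspond to
backtracking, because edges are determined by their labels. -/
theorem HasPath.normalForm (hf : Ω.Folded) (hc : Ω.CubeFull) {w : List S} {p q : Ω.Vertex}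
    (h : Ω.HasPath p w q) : Ω.HasPath p (RACGWord.normalForm Γ w) q := by
  induction w generalizing p with
  | nil => exact h
  | cons x w ih =>
    obtain ⟨r, hr, h⟩ := hasPath_cons.1 h
    change Ω.HasPath p (RACGWord.leftMul Γ x (RACGWord.normalForm Γ w)) q
    cases hx : RACGWord.eraseFront Γ x (RACGWord.normalForm Γ w) with
    | none =>
      rw [RACGWord.leftMul_of_none hx]
      exact hasPath_cons.2 ⟨r, hr, ih h⟩
    | some v =>
      rw [RACGWord.leftMul_of_some hx]
      obtain ⟨p', hp', h'⟩ :=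
        hasPath_cons.1 ((ih h).shuffle hf hc (RACGWord.shuffle_of_eraseFront hx))
      rwa [hf.step_unique hr.symm hp']

/-- If the label of a path represents the same element of `W_Γ` as a word without cancellation, then
this word is the label of a path with the same endpoints. -/
theorem HasPath.of_noCancel (hf : Ω.Folded) (hc : Ω.CubeFull) {w w' : List S} {p q : Ω.Vertex}
    (h : Ω.HasPath p w q) (hw : wordElt Γ w = wordElt Γ w') (hw' : RACGWord.NoCancel Γ w') :
    Ω.HasPath p w' q := by
  have h' := (h.normalForm hf hc).shuffle hf hc (RACGWord.shuffle_normalForm hw)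
  rwa [RACGWord.normalForm_eq_self hw'] at h'

/-! ### Full valence and the index -/

/-- In a complex of full valence, `W_Γ` acts on the vertices so that each generator `s` moves every
vertex along its edge labeled by `s`. As this is a left action, a path labeled by `w` leads from
`w • q` to `q`. -/
theorem FullValence.exists_action (hv : Ω.FullValence) (hf : Ω.Folded) (hc : Ω.CubeFull) :
    ∃ φ : RACG Γ →* Function.End Ω.Vertex,
      ∀ (w : List S) (p q : Ω.Vertex), Ω.HasPath p w q ↔ φ (wordElt Γ w) q = p := by
  choose f₀ hstep using fun (s : S) (p : Ω.Vertex) => (hv p s).exists_step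
  let f : S → Function.End Ω.Vertex := f₀
  have hsq : ∀ s, f s * f s = 1 := fun s => funext fun p =>
    hf.step_unique (hstep s (f s p)) (hstep s p).symm
  have hcomm : ∀ s t, Γ.Adj s t → f s * f t = f t * f s := by
    intro s t hst
    funext p
    obtain ⟨z, hz, hz'⟩ := exists_square hf hc hst (hstep s p) (hstep t p)
    exact (hf.step_unique (hstep s (f t p)) hz').trans (hf.step_unique (hstep t (f s p)) hz).symm
  obtain ⟨φ, hφ⟩ := exists_monoidHom_wordElt Γ f hsq hcomm
  refine ⟨φ, fun w => ?_⟩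
  rw [hφ]
  induction w with
  | nil => exact fun p q => hasPath_nil.trans eq_comm
  | cons s w ih =>
    intro p q
    rw [hasPath_cons]
    change _ ↔ f s ((w.map f).prod q) = p
    constructor
    · rintro ⟨r, hr, h⟩
      rw [(ih r q).1 h]
      exact hf.step_unique (hstep s r) hr.symm
    · rintro rfl
      exact ⟨_, (hstep s _).symm, (ih _ q).2 rfl⟩

theorem IsCompletion.index_eq {B : Ω.Vertex} {G : Subgroup (RACG Γ)} (hΩ : Ω.IsCompletion B G)
    (hv : Ω.FullValence) : Cardinal.lift.{v} #(RACG Γ ⧸ G) = Cardinal.lift.{u} #Ω.Vertex := by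
  obtain ⟨φ, hφ⟩ := hv.exists_action hΩ.folded hΩ.cubeFull
  let : MulAction (RACG Γ) Ω.Vertex := MulAction.ofEndHom φ
  have hG : MulAction.stabilizer (RACG Γ) B = G := by
    ext g
    obtain ⟨w, hw, rfl⟩ := exists_isReducedWord Γ g
    exact (hφ w B B).symm.trans ⟨hΩ.loop_mem w, hΩ.reduced_loop w hw⟩
  have horb : MulAction.orbit (RACG Γ) B = Set.univ := by
    refine Set.eq_univ_of_forall fun p => ?_
    obtain ⟨w, hw⟩ := hΩ.connected p B
    exact ⟨wordElt Γ w, (hφ w p B).1 hw⟩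
  have e := MulAction.orbitEquivQuotientStabilizer (RACG Γ) B
  rw [hG, horb] at e
  exact Cardinal.lift_mk_eq'.2 ⟨e.symm.trans (Equiv.Set.univ _)⟩

/-! ### Subgroups of finite index -/

theorem HasEdgeAt.of_hasPath (hf : Ω.Folded) (hc : Ω.CubeFull) {s : S}
    (hs : insert s (Γ.neighborSet s) = Set.univ) {p q : Ω.Vertex} {w : List S}
    (h : Ω.HasPath p w q) (hq : Ω.HasEdgeAt q s) : Ω.HasEdgeAt p s := by
  induction w generalizing p with
  | nil => exact hasPath_nil.1 h ▸ hq
  | cons x w ih =>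
    obtain ⟨r, hr, h⟩ := hasPath_cons.1 h
    obtain ⟨r', hr'⟩ := (ih h).exists_step
    rcases (hs ▸ Set.mem_univ x : x ∈ insert s (Γ.neighborSet s)) with rfl | hx
    · exact hr.hasEdgeAt
    · obtain ⟨z, hz, -⟩ := exists_square hf hc hx hr' hr.symm
      obtain ⟨z, hz, -⟩ := exists_square hf hc (SimpleGraph.Adj.symm hx) hr.symm hr'
      exact hz.hasEdgeAt

/-- If `s` does not commute with all other generators, then every vertex is incident to an edge
labeled by `s`. Indeed, let `t` be a generator not commuting with `s`, and `w` the label of a path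
from `B` to `p`. Some power of `w * (s * t) * w⁻¹` lies in `G`, so it is represented by a loop at
`B`. Conjugating this loop by the path gives a loop at `p` which represents a power of `s * t`, and
the word `st⋯st` is then also the label of a loop at `p`. -/
theorem IsCompletion.hasEdgeAt_of_not_adj {B : Ω.Vertex} {G : Subgroup (RACG Γ)}
    (hΩ : Ω.IsCompletion B G) (hG : G.FiniteIndex) {s t : S} (hne : s ≠ t) (hst : ¬ Γ.Adj s t)
    (p : Ω.Vertex) : Ω.HasEdgeAt p s := by
  obtain ⟨w, hw⟩ := hΩ.connected B p
  obtain ⟨n, hn, -, hmem⟩ := Subgroup.exists_pow_mem_of_index_ne_zero hG.index_ne_zero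
    (wordElt Γ w * wordElt Γ [s, t] * (wordElt Γ w)⁻¹)
  rw [conj_pow] at hmem
  obtain ⟨r, hr, hrel⟩ := exists_isReducedWord Γ
    (wordElt Γ w * wordElt Γ [s, t] ^ n * (wordElt Γ w)⁻¹)
  have hloop := (hw.reverse.append (hΩ.reduced_loop r hr (hrel ▸ hmem))).append hw
  have h := hloop.of_noCancel hΩ.folded hΩ.cubeFull
    (w' := (List.replicate n [s, t]).flatten) (by
      rw [wordElt_append, wordElt_append, wordElt_reverse, hrel, RACGWord.wordElt_alternating]
      group) (RACGWord.noCancel_alternating hne hst n)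
  obtain ⟨n, rfl⟩ := Nat.exists_eq_succ_of_ne_zero hn.ne'
  obtain ⟨q, hq, -⟩ := hasPath_cons.1 h
  exact hq.hasEdgeAt

theorem IsCompletion.fullValence {B : Ω.Vertex} {G : Subgroup (RACG Γ)}
    (hΩ : Ω.IsCompletion B G) (hres : Ω.Resolved) (hG : G.FiniteIndex) : Ω.FullValence := by
  intro p s
  by_cases hs : insert s (Γ.neighborSet s) = Set.univ
  · obtain ⟨e, he⟩ := hres s hs
    obtain ⟨w, hw⟩ := hΩ.connected p (src e)
    exact HasEdgeAt.of_hasPath hΩ.folded hΩ.cubeFull hs hw ⟨e, rfl, he⟩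
  · obtain ⟨t, ht⟩ := (Set.ne_univ_iff_exists_notMem _).1 hs
    rw [Set.mem_insert_iff, not_or] at ht
    exact hΩ.hasEdgeAt_of_not_adj hG (Ne.symm ht.1) ht.2 p

/-- The labels at a corner of a cube are distinct, so the dimension is bounded by the number of
labels. -/
theorem dim_le_card [Finite S] {n : ℕ} (c : Ω.Cube n) : n ≤ Nat.card S := by
  have h : Function.Injective fun j : Fin n =>
      Ω.label (Ω.res (CubeEmb.edge j fun _ => false) c) := by
    intro i j hij
    by_contra hne
    exact (Ω.label_corner c (CubeEmb.edge i fun _ => false) (CubeEmb.edge j fun _ => false) rfl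
      hne).ne hij
  simpa using Nat.card_le_card_of_injective _ h

theorem Folded.isFinite [Finite S] (hf : Ω.Folded) [Finite Ω.Vertex] : Ω.IsFinite := by
  have hfin : ∀ n, Finite (Ω.Cube n) := by
    intro n
    induction n using Nat.strong_induction_on with
    | _ n ih =>
      match n with
      | 0 => infer_instance
      | 1 =>
        exact finite_cube_of_sameCell (fun e => (src e, Ω.label e)) fun e e' h =>
          hf.no_fold e e' (congrArg Prod.fst h) (congrArg Prod.snd h)
      | n + 2 =>
        have : ∀ m : Fin (n + 2), Finite (Ω.Cube m) := fun m => ih m m.2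
        exact finite_cube_of_sameCell
          (fun x => fun (m : Fin (n + 2)) (f : CubeEmb m (n + 2)) => Ω.res f x) fun x y h =>
            hf.no_cube_identification (n + 2) x y (Nat.le_add_left 2 n) fun m f hm =>
              congrFun (congrFun h ⟨m, hm⟩) f
  refine Finite.of_injective (β := Σ n : Fin (Nat.card S + 1), Ω.Cube n)
    (fun c => ⟨⟨c.1, Nat.lt_succ_of_le (dim_le_card c.2)⟩, c.2⟩) ?_
  rintro ⟨m, x⟩ ⟨n, y⟩ h
  simp only [Sigma.mk.injEq, Fin.mk.injEq] at h
  obtain ⟨rfl, h⟩ := h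
  rw [eq_of_heq h]

end LabeledCubeComplex

theorem mainTheorem2 {S : Type u} [Finite S] (Γ : SimpleGraph S) (G : Subgroup (RACG Γ))
    (Ω : LabeledCubeComplex.{u, v} Γ) (B : Ω.Vertex) (hΩ : Ω.IsCompletion B G) :
    (Ω.Resolved → (G.FiniteIndex ↔ Ω.IsFinite ∧ Ω.FullValence)) ∧
    (Ω.FullValence → Cardinal.lift.{v} #(RACG Γ ⧸ G) = Cardinal.lift.{u} #Ω.Vertex) := by
  have hfin : Ω.FullValence → (Finite (RACG Γ ⧸ G) ↔ Finite Ω.Vertex) := fun hv =>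
    (Cardinal.lift_mk_eq'.1 (hΩ.index_eq hv)).some.finite_iff
  refine ⟨fun hres => ⟨fun hG => ?_, fun ⟨hΩfin, hv⟩ => ?_⟩, hΩ.index_eq⟩
  · have hv := hΩ.fullValence hres hG
    have : Finite Ω.Vertex := (hfin hv).1 inferInstance
    exact ⟨hΩ.folded.isFinite, hv⟩
  · have : Finite (Σ n, Ω.Cube n) := hΩfin
    exact Subgroup.finiteIndex_iff_finite_quotient.2
      ((hfin hv).2 (Finite.of_injective (Sigma.mk 0) sigma_mk_injective))
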